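/- Let $f(x) = \exp(\arctan x) \in \mathbb{Q}[[x]]$ be the composition of the formal power series $\exp(x) = \sum_{n \ge 0} \frac{x^n}{n!}$ and $\arctan(x) = \sum_{n \ge 0} \frac{(-1)^n}{2n+1} x^{2n+1}$. For a prime $p$, let $\mathbb{Z}_{(p)} \subseteq \mathbb{Q}$ be the ring of rational numbers whose denominator in lowest terms is not divisible by $p$. Then for every prime $p \equiv 1 \pmod 4$, the series $f(x)$ belongs to $\mathbb{Z}_{(p)}[[x]]$, and the series $f(x) \bmod p \in \mathbb{F}_p[[x]]$ obtained by reducing its coefficients modulo $p$, regarded as an element of the field of formal Laurent series $\mathbb{F}_p((x))$, is transcendental over the field of rational functions $\mathbb{F}_p(x)$. -/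

import Mathlib

open scoped RatFunc

/-- The Taylor series of `arctan` at `0`, over `ℚ`:
`arctan x = x - x ^ 3 / 3 + x ^ 5 / 5 - ⋯`. -/
noncomputable def arctanSeries : PowerSeries ℚ :=
  PowerSeries.mk fun n => if Odd n then (-1 : ℚ) ^ (n / 2) / (n : ℚ) else 0

/-- The series `arctan x` has no constant term, so it may be substituted into any power series. -/
theorem hasSubst_arctanSeries : PowerSeries.HasSubst arctanSeries :=
  PowerSeries.HasSubst.of_constantCoeff_zero' (by
    rw [← PowerSeries.coeff_zero_eq_constantCoeff_apply]
    simp [arctanSeries])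

/-- The series `exp (arctan x)` in `ℚ⟦x⟧`: the composition of the exponential series with the
series `arctan x`. -/
noncomputable def expArctanSeries : PowerSeries ℚ :=
  (PowerSeries.exp ℚ).subst arctanSeries

/-- The series `f` lies in `ℤ_(p)⟦x⟧`: no coefficient, written in lowest terms, has a denominator
divisible by `p`. -/
def IsIntegralAt (p : ℕ) (f : PowerSeries ℚ) : Prop :=
  ∀ n : ℕ, ¬ p ∣ (PowerSeries.coeff n f).den

/-- The reduction `f mod p` in `𝔽_p⟦x⟧`, coefficient by coefficient: a coefficient `a / b` in
lowest terms is sent to `(a mod p) / (b mod p)`. It is meaningful for `f` in `ℤ_(p)⟦x⟧`, where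
every `b mod p` is nonzero. -/
noncomputable def reductionMod (p : ℕ) [Fact p.Prime] (f : PowerSeries ℚ) :
    PowerSeries (ZMod p) :=
  PowerSeries.mk fun n =>
    ((PowerSeries.coeff n f).num : ZMod p) / ((PowerSeries.coeff n f).den : ZMod p)

/-!
The derivative of `arctan` is `1 / (1 + X ^ 2)`, so `f = exp (arctan X)` is the solution of
`(1 + X ^ 2) (d/dX) f = f` with constant term `1`. For `p ≡ 1 [MOD 4]` the ring `ℤ_[p]` contains `i`
with `i ^ 2 = -1` and `a` with `2 i a = 1`, so `f = w ^ a` where `w = (1 + i X) / (1 - i X)`. The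
powers `w ^ b` with `b : ℤ_[p]` have coefficients in `ℤ_[p]`, whence the integrality of `f`.

Modulo `p`, the Frobenius gives `w ^ b ≡ w ^ (b mod p ^ k)` modulo `(w - 1) ^ p ^ k`. A linear
relation between distinct powers `w ^ b` thus yields, for large `k`, a polynomial in `w` of degree
less than `p ^ k` that is divisible by `(w - 1) ^ p ^ k`, so the relation is trivial. As
`(2 a) ^ 2 = -1`, the exponents `1` and `a` are linearly independent over `ℤ`; hence `w` and `w ^ a`
are algebraically independent over `ZMod p`. Since `X` is a rational function of `w`, this makes
`w ^ a` transcendental over the rational functions in `X`.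
-/

section FormalPowerSeries

open PowerSeries

theorem constantCoeff_map {R S : Type*} [Semiring R] [Semiring S] (φ : R →+* S) (f : R⟦X⟧) :
    constantCoeff (map φ f) = φ (constantCoeff f) := by
  rw [← coeff_zero_eq_constantCoeff_apply, coeff_map, coeff_zero_eq_constantCoeff_apply]

theorem derivative_map {R S : Type*} [CommSemiring R] [CommSemiring S] (φ : R →+* S)
    (f : R⟦X⟧) : d⁄dX S (map φ f) = map φ (d⁄dX R f) := by
  ext n
  simp [coeff_derivative]

theorem derivative_rescale {R : Type*} [CommSemiring R] (c : R) (f : R⟦X⟧) :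
    d⁄dX R (rescale c f) = C c * rescale c (d⁄dX R f) := by
  ext n
  simp only [coeff_derivative, coeff_rescale, coeff_C_mul]
  ring

theorem rescale_C {R : Type*} [CommSemiring R] (c r : R) : rescale c (C r) = C r := by
  ext n
  rcases eq_or_ne n 0 with rfl | hn
  · simp
  · simp [coeff_C, hn]

theorem constantCoeff_rescale {R : Type*} [CommSemiring R] (c : R) (f : R⟦X⟧) :
    constantCoeff (rescale c f) = constantCoeff f := by
  rw [← coeff_zero_eq_constantCoeff_apply, coeff_rescale, pow_zero, one_mul,
    coeff_zero_eq_constantCoeff_apply]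

theorem eq_of_mul_derivative_eq_mul {K : Type*} [Field K] [CharZero K] {q r f g : K⟦X⟧}
    (hq : q ≠ 0) (hf : q * d⁄dX K f = r * f) (hg : q * d⁄dX K g = r * g)
    (hfg : constantCoeff f = constantCoeff g) (hg0 : constantCoeff g ≠ 0) : f = g := by
  have hwronskian : d⁄dX K f * g = f * d⁄dX K g := by
    apply mul_left_cancel₀ hq
    linear_combination g * hf - f * hg
  have hquot : f * g⁻¹ = 1 := by
    apply derivative.ext
    · rw [Derivation.leibniz, derivative_inv', smul_eq_mul, smul_eq_mul, derivative_one]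
      linear_combination g⁻¹ ^ 2 * hwronskian - g⁻¹ * d⁄dX K f * PowerSeries.mul_inv_cancel g hg0
    · simp [hfg, hg0]
  rw [← mul_one f, ← PowerSeries.inv_mul_cancel g hg0, ← mul_assoc, hquot, one_mul]

theorem succ_mul_choose_succ {R : Type*} [CommRing R] [BinomialRing R] (r : R) (n : ℕ) :
    ((n : R) + 1) * Ring.choose r (n + 1) = (r - n) * Ring.choose r n := by
  simpa [nsmul_eq_mul, mul_comm] using Ring.choose_smul_choose r n.le_succ

theorem one_add_X_mul_derivative_binomialSeries {R : Type*} [CommRing R] [BinomialRing R] (r : R) :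
    (1 + X) * d⁄dX R (binomialSeries R r) = C r * binomialSeries R r := by
  ext n
  rw [add_mul, one_mul, map_add, coeff_C_mul]
  cases n with
  | zero => simp [coeff_derivative]
  | succ n =>
    have hchoose := succ_mul_choose_succ r (n + 1)
    simp only [coeff_succ_X_mul, coeff_derivative, binomialSeries_coeff, smul_eq_mul, mul_one]
    push_cast at hchoose ⊢
    linear_combination hchoose

theorem one_add_C_mul_X_mul_derivative_rescale_binomialSeries {R : Type*} [CommRing R]
    [BinomialRing R] (c r : R) :
    (1 + C c * X) * d⁄dX R (rescale c (binomialSeries R r)) =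
      C (c * r) * rescale c (binomialSeries R r) := by
  have hrescaled := congrArg (rescale c) (one_add_X_mul_derivative_binomialSeries r)
  simp only [map_mul, map_add, map_one, rescale_X, rescale_C] at hrescaled
  rw [derivative_rescale, map_mul]
  linear_combination C c * hrescaled

end FormalPowerSeries

section ExpArctan

open PowerSeries

theorem one_add_X_sq_mul_derivative_arctanSeries :
    (1 + X ^ 2) * d⁄dX ℚ arctanSeries = 1 := by
  have hcoeff (n : ℕ) : coeff n (d⁄dX ℚ arctanSeries) = if Even n then (-1) ^ (n / 2) else 0 := by
    have hn : (n : ℚ) + 1 ≠ 0 := n.cast_add_one_ne_zero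
    rcases n.even_or_odd with he | ho
    · have hdiv : (n + 1) / 2 = n / 2 := by grind
      simp [coeff_derivative, arctanSeries, he, he.add_one, hdiv, hn]
    · simp [coeff_derivative, arctanSeries, Nat.not_even_iff_odd.2 ho,
        Nat.not_odd_iff_even.2 ho.add_one]
  ext n
  rw [add_mul, one_mul, map_add, coeff_X_pow_mul', coeff_one, hcoeff]
  rcases n with _ | _ | n
  · simp
  · simp
  · have heven : Even (n + 2) ↔ Even n := by grind
    have hdiv : (n + 1 + 1) / 2 = n / 2 + 1 := by lia
    by_cases he : Even n <;> simp [hcoeff, heven, he, hdiv, pow_succ]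

theorem one_add_X_sq_mul_derivative_expArctanSeries :
    (1 + X ^ 2) * d⁄dX ℚ expArctanSeries = expArctanSeries := by
  rw [expArctanSeries, derivative_subst hasSubst_arctanSeries, derivative_exp]
  linear_combination (exp ℚ).subst arctanSeries * one_add_X_sq_mul_derivative_arctanSeries

theorem constantCoeff_arctanSeries : constantCoeff arctanSeries = 0 := by
  rw [← coeff_zero_eq_constantCoeff_apply]
  simp [arctanSeries]

theorem constantCoeff_expArctanSeries : constantCoeff expArctanSeries = 1 := by
  have hexp : constantCoeff ((exp ℚ - 1).subst arctanSeries) = 0 :=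
    constantCoeff_subst_eq_zero constantCoeff_arctanSeries _ (by simp)
  have hone : (1 : ℚ⟦X⟧).subst arctanSeries = (1 : ℚ⟦X⟧) := by
    rw [← coe_substAlgHom hasSubst_arctanSeries, map_one]
  rw [subst_sub hasSubst_arctanSeries, hone, map_sub, map_one, sub_eq_zero] at hexp
  exact hexp

end ExpArctan

section Cayley

open PowerSeries

/-- The additive character `b ↦ ((1 + c X) / (1 - c X)) ^ b`, the powers being binomial series. -/
noncomputable def cayleyChar {R : Type*} [CommRing R] [BinomialRing R] (c : R) :
    AddChar R R⟦X⟧ where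
  toFun b := rescale c (binomialSeries R b) * rescale (-c) (binomialSeries R (-b))
  map_zero_eq_one' := by simp
  map_add_eq_mul' a b := by
    simp only [neg_add, binomialSeries_add, map_mul]
    ring

variable {R : Type*} [CommRing R] [BinomialRing R]

theorem cayleyChar_apply (c b : R) :
    cayleyChar c b = rescale c (binomialSeries R b) * rescale (-c) (binomialSeries R (-b)) := rfl

theorem constantCoeff_cayleyChar (c b : R) : constantCoeff (cayleyChar c b) = 1 := by
  simp [cayleyChar_apply, constantCoeff_rescale]

theorem cayleyChar_one_mul (c : R) : cayleyChar c 1 * (1 - C c * X) = 1 + C c * X := by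
  have hone (d : R) : rescale d (binomialSeries R (1 : R)) = 1 + C d * X := by
    have hbinom : binomialSeries R (1 : R) = 1 + X := by
      simpa using binomialSeries_nat (R := R) (A := R) 1
    simp [hbinom, rescale_X]
  have hcancel : rescale (-c) (binomialSeries R (-1 : R)) * (1 - C c * X) = 1 := by
    rw [show 1 - C c * X = rescale (-c) (binomialSeries R (1 : R)) by
      simp [hone, sub_eq_add_neg], ← map_mul, ← binomialSeries_add]
    simp
  rw [cayleyChar_apply, mul_assoc, hcancel, mul_one, hone]

theorem one_add_X_sq_mul_derivative_cayleyChar {i : R} (hi : i ^ 2 = -1) (b : R) :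
    (1 + X ^ 2) * d⁄dX R (cayleyChar i b) = C (2 * i * b) * cayleyChar i b := by
  have hpos := one_add_C_mul_X_mul_derivative_rescale_binomialSeries i b
  have hneg := one_add_C_mul_X_mul_derivative_rescale_binomialSeries (-i) (-b)
  have hiC : (C i : R⟦X⟧) ^ 2 = -1 := by rw [← map_pow, hi, map_neg, map_one]
  simp only [map_mul, map_neg, map_ofNat] at hpos hneg ⊢
  rw [cayleyChar_apply, Derivation.leibniz, smul_eq_mul, smul_eq_mul]
  set P := rescale i (binomialSeries R b)
  set Q := rescale (-i) (binomialSeries R (-b))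
  linear_combination (1 + C i * X) * P * hneg + (1 - C i * X) * Q * hpos +
    X ^ 2 * (P * d⁄dX R Q + Q * d⁄dX R P) * hiC

end Cayley

section PadicInt

open PowerSeries

variable {p : ℕ} [Fact p.Prime]

theorem map_expArctanSeries {i a : ℤ_[p]} (hi : i ^ 2 = -1) (ha : 2 * i * a = 1) :
    map (algebraMap ℚ ℚ_[p]) expArctanSeries = map (algebraMap ℤ_[p] ℚ_[p]) (cayleyChar i a) := by
  have hq : (1 + X ^ 2 : ℚ_[p]⟦X⟧) ≠ 0 := fun h => by simpa using congrArg constantCoeff h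
  have hode {R : Type} [CommRing R] (φ : R →+* ℚ_[p]) {f : R⟦X⟧}
      (hf : (1 + X ^ 2) * d⁄dX R f = f) :
      (1 + X ^ 2) * d⁄dX ℚ_[p] (map φ f) = 1 * map φ f := by
    simpa [derivative_map] using congrArg (map φ) hf
  refine eq_of_mul_derivative_eq_mul hq (hode _ one_add_X_sq_mul_derivative_expArctanSeries)
    (hode _ ?_) ?_ ?_
  · rw [one_add_X_sq_mul_derivative_cayleyChar hi, ha, map_one, one_mul]
  · rw [constantCoeff_map, constantCoeff_map, constantCoeff_expArctanSeries,
      constantCoeff_cayleyChar, map_one, map_one]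
  · rw [constantCoeff_map, constantCoeff_cayleyChar, map_one]
    exact one_ne_zero

end PadicInt

section Reduction

open PowerSeries

variable {p : ℕ} [Fact p.Prime]

theorem not_dvd_den_of_coe_eq_coe {q : ℚ} {z : ℤ_[p]} (h : (q : ℚ_[p]) = z) : ¬p ∣ q.den :=
  Rat.padicValuation_le_one_iff.1 <| (Padic.norm_rat_le_one_iff_padicValuation_le_one p).1 <|
    h ▸ z.norm_le_one

theorem num_div_den_eq_toZMod {q : ℚ} {z : ℤ_[p]} (h : (q : ℚ_[p]) = z) :
    (q.num : ZMod p) / (q.den : ZMod p) = PadicInt.toZMod z := by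
  have hden : (q.den : ZMod p) ≠ 0 := by
    rw [Ne, ZMod.natCast_eq_zero_iff]
    exact not_dvd_den_of_coe_eq_coe h
  have hmul : z * q.den = q.num := by
    apply PadicInt.ext
    push_cast
    rw [← h]
    exact_mod_cast q.mul_den_eq_num
  rw [div_eq_iff hden]
  simpa using congrArg PadicInt.toZMod hmul.symm

variable {f : ℚ⟦X⟧} {g : ℤ_[p]⟦X⟧}

theorem isIntegralAt_of_map_eq
    (h : map (algebraMap ℚ ℚ_[p]) f = map (algebraMap ℤ_[p] ℚ_[p]) g) : IsIntegralAt p f :=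
  fun n => not_dvd_den_of_coe_eq_coe (z := coeff n g) (by simpa using congrArg (coeff n) h)

theorem reductionMod_eq_map_toZMod
    (h : map (algebraMap ℚ ℚ_[p]) f = map (algebraMap ℤ_[p] ℚ_[p]) g) :
    reductionMod p f = map PadicInt.toZMod g := by
  ext n
  rw [reductionMod, coeff_mk, coeff_map]
  exact num_div_den_eq_toZMod (by simpa using congrArg (coeff n) h)

end Reduction

section AlgebraicIndependence

open Polynomial

theorem X_sub_C_pow_dvd_of_sub_pow_dvd_aeval {K A : Type*} [Field K] [CommRing A] [IsDomain A]
    [Algebra K A] {u : A} {r : K} (hur : u - algebraMap K A r ≠ 0)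
    (hunit : ¬IsUnit (u - algebraMap K A r)) {n : ℕ} {P : K[X]}
    (h : (u - algebraMap K A r) ^ n ∣ aeval u P) : (X - C r) ^ n ∣ P := by
  induction n generalizing P with
  | zero => simp
  | succ n ih =>
    have hroot : P.eval r = 0 := by
      by_contra hP
      apply hunit
      have hdvd := dvd_sub ((dvd_pow_self _ n.succ_ne_zero).trans h)
        (sub_dvd_eval_sub u (algebraMap K A r) (P.map (algebraMap K A)))
      rw [eval_map_algebraMap, eval_map_algebraMap, sub_sub_cancel,
        aeval_algebraMap_apply_eq_algebraMap_eval] at hdvd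
      exact isUnit_of_dvd_unit hdvd ((IsUnit.mk0 _ hP).map (algebraMap K A))
    obtain ⟨Q, rfl⟩ := dvd_iff_isRoot.2 hroot
    simp only [map_mul, map_sub, aeval_X, aeval_C, pow_succ'] at h ⊢
    exact mul_dvd_mul_left _ (ih ((mul_dvd_mul_iff_left hur).1 h))

theorem algebraicIndependent_of_linearIndependent_prod_pow {ι R A : Type*} [CommRing R]
    [CommRing A] [Algebra R A] {x : ι → A}
    (h : LinearIndependent R fun s : ι →₀ ℕ => s.prod fun i n => x i ^ n) :
    AlgebraicIndependent R x := by
  rw [algebraicIndependent_iff]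
  intro P hP
  ext s
  by_contra hs
  rw [MvPolynomial.aeval_def, MvPolynomial.eval₂_eq] at hP
  simp only [← Algebra.smul_def] at hP
  exact hs <| linearIndependent_iff'.1 h P.support (P.coeff ·) hP s <|
    MvPolynomial.mem_support_iff.2 hs

end AlgebraicIndependence

section PadicCharacter

theorem addChar_sum {ι G M : Type*} [AddCommMonoid G] [CommMonoid M] (χ : AddChar G M)
    (s : Finset ι) (f : ι → G) : χ (∑ i ∈ s, f i) = ∏ i ∈ s, χ (f i) :=
  map_sum χ.toAddMonoidHom f s

open Polynomial

variable {p : ℕ} [Fact p.Prime]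

theorem exists_injOn_appr (s : Finset ℤ_[p]) : ∃ k, Set.InjOn (fun b : ℤ_[p] => b.appr k) s := by
  obtain ⟨k, hk⟩ : ∃ k, ∀ b ∈ s, ∀ c ∈ s, (b - c).valuation < k :=
    ⟨(s ×ˢ s).sup (fun x => (x.1 - x.2).valuation) + 1, fun _ hb c hc => Nat.lt_succ_of_le <|
      Finset.le_sup (f := fun x => (x.1 - x.2).valuation) (Finset.mk_mem_product hb hc)⟩
  refine ⟨k, fun b hb c hc (hbc : b.appr k = c.appr k) => ?_⟩
  by_contra hne
  have hmem : b - c ∈ Ideal.span {(p : ℤ_[p]) ^ k} := by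
    simpa [hbc] using Ideal.sub_mem _ (PadicInt.appr_spec k b) (PadicInt.appr_spec k c)
  rw [PadicInt.mem_span_pow_iff_le_valuation _ (sub_ne_zero.2 hne)] at hmem
  exact (hk b hb c hc).not_ge hmem

variable {K A : Type*} [CommRing A] {χ : AddChar ℤ_[p] A}

theorem sub_one_pow_dvd_sub_pow_appr [CharP A p] (hχ : ∀ b, χ 1 - 1 ∣ χ b - 1) (b : ℤ_[p])
    (k : ℕ) : (χ 1 - 1) ^ p ^ k ∣ χ b - χ 1 ^ b.appr k := by
  obtain ⟨c, hc⟩ := Ideal.mem_span_singleton'.1 (PadicInt.appr_spec k b)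
  have hb : b = b.appr k • 1 + p ^ k • c := by
    simp only [nsmul_eq_mul, Nat.cast_pow]
    linear_combination -hc
  -- The Frobenius turns `χ (p ^ k • c) - 1` into `(χ c - 1) ^ p ^ k`.
  have hfrob : χ b - χ 1 ^ b.appr k = χ 1 ^ b.appr k * (χ c - 1) ^ p ^ k := by
    rw [sub_pow_char_pow, one_pow, mul_sub_one, ← χ.map_nsmul_eq_pow, ← χ.map_nsmul_eq_pow,
      ← χ.map_add_eq_mul, ← hb]
  rw [hfrob]
  exact (pow_dvd_pow_of_dvd (hχ c) _).mul_left _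

variable [Field K] [IsDomain A] [Algebra K A] [CharP A p]

theorem linearIndependent_addChar (hne : χ 1 - 1 ≠ 0) (hunit : ¬IsUnit (χ 1 - 1))
    (hχ : ∀ b, χ 1 - 1 ∣ χ b - 1) : LinearIndependent K χ := by
  rw [linearIndependent_iff']
  intro s g hg b hb
  obtain ⟨k, hk⟩ := exists_injOn_appr s
  set P : K[X] := ∑ c ∈ s, C (g c) * X ^ c.appr k with hP
  have haeval : aeval (χ 1) P = -∑ c ∈ s, g c • (χ c - χ 1 ^ c.appr k) := by
    simp only [hP, map_sum, map_mul, map_pow, aeval_C, aeval_X, smul_sub, Finset.sum_sub_distrib,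
      hg, zero_sub, neg_neg, ← Algebra.smul_def]
  have hdvd : (X - C 1) ^ p ^ k ∣ P := by
    apply X_sub_C_pow_dvd_of_sub_pow_dvd_aeval (u := χ 1) <;> rw [map_one (algebraMap K A)]
    · exact hne
    · exact hunit
    · rw [haeval, dvd_neg]
      exact Finset.dvd_sum fun c _ => dvd_smul_of_dvd _ (sub_one_pow_dvd_sub_pow_appr hχ c k)
  have hdegree : P.degree < ((X - C 1 : K[X]) ^ p ^ k).degree := by
    rw [degree_pow, degree_X_sub_C, nsmul_one]
    refine (degree_sum_le _ _).trans_lt ((Finset.sup_lt_iff (WithBot.bot_lt_coe _)).2 fun c _ => ?_)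
    exact (degree_C_mul_X_pow_le _ _).trans_lt (by exact_mod_cast c.appr_lt k)
  have hcoeff : P.coeff (b.appr k) = g b := by
    rw [hP, finsetSum_coeff, Finset.sum_eq_single_of_mem b hb]
    · simp
    · intro c hc hcb
      rw [coeff_C_mul_X_pow, if_neg fun h => hcb (hk hc hb h.symm)]
  rw [← hcoeff, eq_zero_of_dvd_of_degree_lt hdvd hdegree, coeff_zero]

theorem algebraicIndependent_addChar (hne : χ 1 - 1 ≠ 0) (hunit : ¬IsUnit (χ 1 - 1))
    (hχ : ∀ b, χ 1 - 1 ∣ χ b - 1) {ι : Type*} {b : ι → ℤ_[p]} (hb : LinearIndependent ℕ b) :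
    AlgebraicIndependent K (χ ∘ b) := by
  apply algebraicIndependent_of_linearIndependent_prod_pow
  have hprod : (fun s : ι →₀ ℕ => s.prod fun i n => (χ ∘ b) i ^ n) =
      χ ∘ Finsupp.linearCombination ℕ b := by
    ext s
    simp only [Finsupp.linearCombination_apply, Finsupp.sum, Finsupp.prod, Function.comp_apply,
      addChar_sum, AddChar.map_nsmul_eq_pow]
  rw [hprod]
  exact (linearIndependent_addChar hne hunit hχ).comp _ hb

end PadicCharacter

section Transcendence

open PowerSeries

variable {K : Type*} [Field K]

theorem transcendental_ofPowerSeries {g : K⟦X⟧}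
    (hg : Transcendental (Algebra.adjoin K {(X : K⟦X⟧)}) g) :
    Transcendental (RatFunc K) (HahnSeries.ofPowerSeries ℤ K g : LaurentSeries K) := by
  let φ : Polynomial K →ₐ[K] Algebra.adjoin K {(X : K⟦X⟧)} :=
    Polynomial.aeval ⟨X, Algebra.self_mem_adjoin_singleton K X⟩
  have hφ : (Algebra.adjoin K {(X : K⟦X⟧)}).val.comp φ =
      Polynomial.coeToPowerSeries.algHom K := by
    ext
    simp [φ]
  have hpoly : Transcendental (Polynomial K) g := by
    refine Transcendental.of_ringHom_of_comp_eq φ (RingHom.id K⟦X⟧) hg ?_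
      (congrArg AlgHom.toRingHom hφ)
    apply Function.Injective.of_comp (f := Subtype.val)
    rw [← Subalgebra.coe_val, ← AlgHom.coe_comp, hφ]
    exact Polynomial.coe_injective K
  rw [Transcendental, ← IsFractionRing.isAlgebraic_iff (Polynomial K) (RatFunc K)]
  exact hpoly.ringHom_of_comp_eq (RingHom.id _) (HahnSeries.ofPowerSeries ℤ K)
    Function.surjective_id HahnSeries.ofPowerSeries_injective rfl

variable {w : K⟦X⟧} {j : K}

theorem associated_sub_one_X (hj : 2 * j ≠ 0) (hw : w * (1 - C j * X) = 1 + C j * X) :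
    Associated (w - 1) X := by
  have hden : IsUnit (1 - C j * X) := by simp [isUnit_iff_constantCoeff]
  have hmul : (w - 1) * (1 - C j * X) = X * C (2 * j) := by
    rw [map_mul, map_ofNat]
    linear_combination hw
  have hright := associated_mul_unit_left X _ ((IsUnit.mk0 _ hj).map (C (R := K)))
  exact (associated_mul_unit_right (w - 1) _ hden).trans (hmul ▸ hright)

theorem isAlgebraic_adjoin_X (hj : 2 * j ≠ 0) (hw : w * (1 - C j * X) = 1 + C j * X) :
    IsAlgebraic (Algebra.adjoin K {w}) (X : K⟦X⟧) := by
  have hwmem : w ∈ Algebra.adjoin K {w} := Algebra.self_mem_adjoin_singleton K w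
  have hne : w + 1 ≠ 0 := fun h => by
    apply left_ne_zero_of_mul hj
    simpa using congrArg constantCoeff (show (C 2 : K⟦X⟧) = 0 by
      rw [map_ofNat]
      linear_combination (1 - C j * X) * h - hw)
  have hmul : (w + 1) * X = j⁻¹ • (w - 1) := by
    rw [eq_inv_smul_iff₀ (right_ne_zero_of_mul hj), smul_eq_C_mul]
    linear_combination -hw
  apply IsAlgebraic.of_mul (mem_nonZeroDivisors_of_ne_zero hne)
  · exact isAlgebraic_algebraMap (⟨_, add_mem hwmem (one_mem _)⟩ : Algebra.adjoin K {w})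
  · rw [hmul]
    exact isAlgebraic_algebraMap
      (⟨_, Subalgebra.smul_mem _ (sub_mem hwmem (one_mem _)) _⟩ : Algebra.adjoin K {w})

variable {p : ℕ} [Fact p.Prime] [CharP K p]

theorem transcendental_ofPowerSeries_addChar {χ : AddChar ℤ_[p] K⟦X⟧} {a : ℤ_[p]}
    (hχ : ∀ b, constantCoeff (χ b) = 1) (hj : 2 * j ≠ 0)
    (hw : χ 1 * (1 - C j * X) = 1 + C j * X) (ha : LinearIndependent ℕ ![1, a]) :
    Transcendental (RatFunc K) (HahnSeries.ofPowerSeries ℤ K (χ a) : LaurentSeries K) := by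
  have hX := associated_sub_one_X hj hw
  have : CharP K⟦X⟧ p := charP_of_injective_ringHom C_injective p
  have hindep : AlgebraicIndependent K (χ ∘ ![1, a]) := by
    refine algebraicIndependent_addChar (hX.ne_zero_iff.2 X_ne_zero)
      (hX.isUnit_iff.not.2 X_prime.not_isUnit) (fun b => hX.dvd_iff_dvd_left.2 ?_) ha
    rw [X_dvd_iff, map_sub, hχ, map_one, sub_self]
  have hadjoin : Transcendental (Algebra.adjoin K {χ 1}) (χ a) := by
    have htrans := hindep.transcendental_adjoin (s := {0}) (i := 1) (by simp)
    rwa [Set.image_singleton] at htrans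
  apply transcendental_ofPowerSeries
  refine fun halg => hadjoin (halg.adjoin_of_forall_isAlgebraic ?_)
  rintro _ ⟨rfl, -⟩
  exact isAlgebraic_adjoin_X hj hw

theorem transcendental_ofPowerSeries_map_cayleyChar (φ : ℤ_[p] →+* K) {i a : ℤ_[p]}
    (hi : φ (2 * i) ≠ 0) (ha : LinearIndependent ℕ ![1, a]) :
    Transcendental (RatFunc K)
      (HahnSeries.ofPowerSeries ℤ K (map φ (cayleyChar i a)) : LaurentSeries K) := by
  rw [map_mul, map_ofNat] at hi
  refine transcendental_ofPowerSeries_addChar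
    (χ := (map φ : ℤ_[p]⟦X⟧ →* K⟦X⟧).compAddChar (cayleyChar i)) (fun b => ?_) hi ?_ ha
  · exact (constantCoeff_map φ (cayleyChar i b)).trans (by rw [constantCoeff_cayleyChar, map_one])
  · simpa using congrArg (map φ) (cayleyChar_one_mul i)

end Transcendence

section SquareRoot

open Polynomial

theorem isSquare_of_isSquare_mk {R : Type*} [CommRing R] {I : Ideal R} [HenselianRing R I] {u : R}
    (hu : IsUnit u) (h2 : IsUnit (2 : R)) (hsq : IsSquare (Ideal.Quotient.mk I u)) :
    IsSquare u := by
  obtain ⟨y, hy⟩ := hsq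
  obtain ⟨x, rfl⟩ := Ideal.Quotient.mk_surjective y
  have hx : IsUnit (Ideal.Quotient.mk I x) := isUnit_of_mul_isUnit_left (hy ▸ hu.map _)
  have hroot : (X ^ 2 - C u).eval x ∈ I := by
    rw [← Ideal.Quotient.eq_zero_iff_mem]
    simp [hy, sq]
  have hsimple : IsUnit (Ideal.Quotient.mk I ((derivative (X ^ 2 - C u)).eval x)) := by
    rw [derivative_sub, derivative_X_pow, derivative_C]
    simpa using! (h2.map (Ideal.Quotient.mk I)).mul hx
  obtain ⟨z, hz, -⟩ := HenselianRing.is_henselian (X ^ 2 - C u)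
    (monic_X_pow_sub_C u two_ne_zero) x hroot hsimple
  refine ⟨z, ?_⟩
  rw [IsRoot.def, eval_sub, eval_pow, eval_X, eval_C, sub_eq_zero] at hz
  rw [← hz, sq]

variable {p : ℕ} [Fact p.Prime]

theorem isUnit_two_padicInt (hp : p ≠ 2) : IsUnit (2 : ℤ_[p]) := by
  rw [PadicInt.isUnit_iff, ← Nat.cast_ofNat, PadicInt.norm_natCast_eq_one_iff]
  exact (Nat.coprime_primes Fact.out Nat.prime_two).2 hp

theorem isSquare_of_isSquare_toZMod (hp : p ≠ 2) {u : ℤ_[p]} (hu : IsUnit u)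
    (hsq : IsSquare (PadicInt.toZMod u)) : IsSquare u := by
  have hresidue := hsq.map PadicInt.residueField.symm
  rw [PadicInt.toZMod_eq_residueField_comp_residue, RingHom.comp_apply,
    RingEquiv.toRingHom_eq_coe, RingHom.coe_coe, RingEquiv.symm_apply_apply] at hresidue
  exact isSquare_of_isSquare_mk hu (isUnit_two_padicInt hp) hresidue

theorem isSquare_neg_one_padicInt (hp : p % 4 = 1) : IsSquare (-1 : ℤ_[p]) := by
  apply isSquare_of_isSquare_toZMod (by lia) isUnit_one.neg
  rw [map_neg, map_one, ZMod.exists_sq_eq_neg_one_iff]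
  lia

theorem linearIndependent_one_of_sq_eq_neg_one {R : Type*} [CommRing R] [CharZero R] {a : R}
    {m : ℤ} (ha : (m * a) ^ 2 = -1) : LinearIndependent ℤ ![1, a] := by
  rw [LinearIndependent.pair_iff]
  intro s t hst
  have hsum : (m * s) ^ 2 + t ^ 2 = 0 := by
    apply Int.cast_injective (α := R)
    simp only [zsmul_eq_mul] at hst
    push_cast
    linear_combination m ^ 2 * (s - t * a) * hst + t ^ 2 * ha
  have ht : t = 0 := by
    apply pow_eq_zero_iff two_ne_zero |>.1
    nlinarith [sq_nonneg (m * s), sq_nonneg t]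
  subst ht
  simpa using hst

end SquareRoot

theorem proposition2p1p1 (p : ℕ) [Fact p.Prime] (hp : p ≡ 1 [MOD 4]) :
    IsIntegralAt p expArctanSeries ∧
      Transcendental (RatFunc (ZMod p))
        (HahnSeries.ofPowerSeries ℤ (ZMod p) (reductionMod p expArctanSeries) :
          LaurentSeries (ZMod p)) := by
  have hp4 : p % 4 = 1 := hp
  obtain ⟨i, hi⟩ := isSquare_neg_one_padicInt (p := p) hp4
  rw [← sq, eq_comm] at hi
  have hiunit : IsUnit i := (isUnit_pow_iff two_ne_zero).1 (hi ▸ isUnit_one.neg)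
  obtain ⟨a, ha⟩ := ((isUnit_two_padicInt (p := p) (by lia)).mul hiunit).exists_right_inv
  have hasq : (2 * a) ^ 2 = -1 := by
    linear_combination 4 * a ^ 2 * hi - (2 * i * a + 1) * ha
  have hmap := map_expArctanSeries hi ha
  refine ⟨isIntegralAt_of_map_eq hmap, ?_⟩
  rw [reductionMod_eq_map_toZMod hmap]
  refine transcendental_ofPowerSeries_map_cayleyChar PadicInt.toZMod
    (left_ne_zero_of_mul (b := PadicInt.toZMod a) ?_)
    ((linearIndependent_one_of_sq_eq_neg_one (m := 2) (by exact_mod_cast hasq)).restrict_scalars' ℕ)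
  rw [← map_mul, ha, map_one]
  exact one_ne_zero
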